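/- Let $G$ be a finite group of order $n$, and let $M=\{(x,y,xy) : x,y\in G\}$ be its multiplication table; for a triple $(x,y,z)\in M$ call $x$ its row, $y$ its column and $z$ its entry. A \emph{regular row transversal} of $G$ is a subset $T\subseteq M$ that contains exactly one triple from each row and in which every $s\in G$ occurs as a column exactly as many times as it occurs as an entry, i.e. $|\{(x,y,z)\in T : y=s\}|=|\{(x,y,z)\in T : z=s\}|$. Let $P(G)$ be the set of all products $g_1g_2\cdots g_n$, where $g_1,\dots,g_n$ is an ordering of all the elements of $G$ (each occurring exactly once). Then the following are equivalent: \begin{enumerate} \item $G$ has a regular row transversal; \item the multiplication table $M$ of $G$ can be partitioned into $n$ mutually disjoint regular row transversals; \item the Sylow $2$-subgroups of $G$ are trivial or non-cyclic; \item $1\in P(G)$. \end{enumerate} -/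

import Mathlib

namespace RowTransversal

variable {S : Type*} [DecidableEq S]

/-- A set `C` of triples (row, column, entry) is column-entry regular if every symbol `s` occurs
as a column in `C` exactly as many times as it occurs as an entry in `C`. -/
def IsRegular (C : Finset (S × S × S)) : Prop :=
  ∀ s : S, (C.filter fun t => t.2.1 = s).card = (C.filter fun t => t.2.2 = s).card

/-- A row `k`-plex of the array of triples `L` is a subset of `L` representing each row
exactly `k` times. -/
def IsRowPlex (L : Finset (S × S × S)) (k : ℕ) (C : Finset (S × S × S)) : Prop :=
  C ⊆ L ∧ ∀ x : S, (C.filter fun t => t.1 = x).card = k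

/-- A regular row transversal of `L`: a selection of a single cell from each row such that
each symbol appears as a column the same number of times as an entry. -/
def IsRegularRowTransversal (L T : Finset (S × S × S)) : Prop :=
  IsRowPlex L 1 T ∧ IsRegular T

/-- The multiplication table of `G`, as the set of triples `(x, y, x * y)`. -/
def multTable (G : Type*) [Mul G] [Fintype G] [DecidableEq G] : Finset (G × G × G) :=
  (Finset.univ : Finset (G × G)).image fun p => (p.1, p.2, p.1 * p.2)

/-- The set `P(H)` of full products of a subset `H` of a group: the values of the products, in
some order, of the elements of `H`, each of them occurring exactly once. -/
def fullProducts {G : Type*} [Group G] (H : Set G) : Set G :=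
  {g | ∃ l : List G, l.Nodup ∧ (∀ x, x ∈ l ↔ x ∈ H) ∧ l.prod = g}

end RowTransversal

/-! A row transversal is a map `c` choosing a column in each row; it is regular when `c x` and `x *
c x` take every value equally often. Its right translates partition the table. Moreover some
permutation `π` satisfies `c (π x) = x * c x`, so the elements of each cycle of `π`, suitably
ordered, multiply to 1; conversely, the suffix products of an ordering with product 1 give such a
`c`.

If the Sylow 2-subgroups are trivial, inverse pairs suffice. If they are noncyclic, fix an
involution `t`. Outside the set of `u` with `u * u = 1` commuting with `t`, the group splits into
inverse pairs and four-element double orbits, all with product 1. Inside it, the pairs `{u, u * t}`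
have product `t`, so only the parity of their number matters. `univ_of_klein` matches the pairs two
by two, unless it finds a commutator equal to `t`; then `univ_of_commutator` uses that commutator to
absorb a leftover `t`. A noncyclic Sylow 2-subgroup supplies one of the two situations.

If a Sylow 2-subgroup is cyclic and nontrivial, transfer maps the group onto it with kernel of odd
order, and every full product goes to its involution. -/

namespace RowTransversal

/-! ### Ordered products and their assembly from blocks. -/

section OrderedProducts

variable {G : Type*} [Group G]

/-- `g` is the product of the elements of `A`, each taken once, in some order. -/
def HasOrderedProd (A : Finset G) (g : G) : Prop :=
  ∃ l : List G, l.Nodup ∧ (∀ x, x ∈ l ↔ x ∈ A) ∧ l.prod = g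

theorem one_mem_fullProducts_iff [Fintype G] :
    (1 : G) ∈ fullProducts (Set.univ : Set G) ↔ HasOrderedProd (Finset.univ : Finset G) 1 := by
  simp [fullProducts, HasOrderedProd]

/-- `x` and the involution `t` generate a dihedral group, with `x` or `x * t` as a reflection that
does not commute with `t`. -/
def IsDihedralWith (t x : G) : Prop := x * t ≠ t * x ∧ (x * x = 1 ∨ x * t * (x * t) = 1)

/-- Ensures that `x` and `x⁻¹` get the same kind of block in the partition of the group. -/
theorem IsDihedralWith.inv_iff {t : G} (ht : t * t = 1) {x : G} :
    IsDihedralWith t x⁻¹ ↔ IsDihedralWith t x := by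
  have htinv : t⁻¹ = t := inv_eq_of_mul_eq_one_left ht
  have ht' (y : G) : t * (t * y) = y := by rw [← mul_assoc, ht, one_mul]
  have key (x : G) (h : IsDihedralWith t x) : IsDihedralWith t x⁻¹ := by
    obtain ⟨h1, h2⟩ := h
    refine ⟨fun h => h1 ?_, h2.imp (fun h => ?_) fun h => ?_⟩
    · have := congrArg (fun y => y⁻¹) h
      simpa [htinv] using this.symm
    · rw [← mul_inv_rev, h, inv_one]
    · rw [← inv_eq_one]
      simp only [mul_inv_rev, inv_inv, htinv]
      have := congrArg (fun y => t * y * t) h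
      simpa [mul_assoc, ht, ht'] using this
  exact ⟨fun h => by simpa using key _ h, key x⟩

variable [DecidableEq G]

theorem HasOrderedProd.of_list {A : Finset G} {g : G} (l : List G) (hl : l.Nodup)
    (hA : A = l.toFinset) (hg : l.prod = g) : HasOrderedProd A g :=
  ⟨l, hl, by simp [hA], hg⟩

theorem HasOrderedProd.empty : HasOrderedProd (∅ : Finset G) 1 :=
  .of_list [] (by simp) (by simp) (by simp)

theorem HasOrderedProd.union {A B : Finset G} {a b : G} (hA : HasOrderedProd A a)
    (hB : HasOrderedProd B b) (hAB : Disjoint A B) : HasOrderedProd (A ∪ B) (a * b) := by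
  obtain ⟨l, hl, hlA, rfl⟩ := hA
  obtain ⟨m, hm, hmB, rfl⟩ := hB
  refine ⟨l ++ m, ?_, by simp [hlA, hmB], by simp⟩
  refine hl.append hm fun x hx hx' => ?_
  exact Finset.disjoint_left.1 hAB ((hlA x).1 hx) ((hmB x).1 hx')

theorem HasOrderedProd.of_sdiff {A B : Finset G} {a b : G} (hBA : B ⊆ A)
    (hB : HasOrderedProd B b) (hA : HasOrderedProd (A \ B) a) : HasOrderedProd A (b * a) := by
  have := hB.union hA Finset.disjoint_sdiff
  rwa [Finset.union_sdiff_of_subset hBA] at this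

/-- If a set is partitioned into blocks each of which has an ordered product `1`, then so has the
whole set. -/
theorem HasOrderedProd.of_blocks (b : G → Finset G) (A : Finset G) (hmem : ∀ x ∈ A, x ∈ b x)
    (hsub : ∀ x ∈ A, b x ⊆ A) (heq : ∀ x ∈ A, ∀ y ∈ b x, b y = b x)
    (hone : ∀ x ∈ A, HasOrderedProd (b x) 1) : HasOrderedProd A 1 := by
  induction A using Finset.strongInduction with
  | H A ih =>
    obtain rfl | ⟨x, hx⟩ := A.eq_empty_or_nonempty
    · exact .empty
    rw [← one_mul (1 : G)]
    refine .of_sdiff (hsub x hx) (hone x hx) (ih _ ?_ ?_ ?_ ?_ ?_)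
    · exact Finset.sdiff_ssubset (hsub x hx) ⟨x, hmem x hx⟩
    · exact fun y hy => hmem y (Finset.mem_sdiff.1 hy).1
    · intro y hy z hz
      rw [Finset.mem_sdiff] at hy ⊢
      refine ⟨hsub y hy.1 hz, fun hzx => hy.2 ?_⟩
      rw [← heq x hx z hzx, heq y hy.1 z hz]
      exact hmem y hy.1
    · exact fun y hy => heq y (Finset.mem_sdiff.1 hy).1
    · exact fun y hy => hone y (Finset.mem_sdiff.1 hy).1

theorem HasOrderedProd.pair_inv {x : G} (hx : x * x = 1 → x = 1) :
    HasOrderedProd ({x, x⁻¹} : Finset G) 1 := by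
  by_cases h : x = 1
  · exact .of_list [1] (by simp) (by simp [h]) (by simp)
  · refine .of_list [x, x⁻¹] ?_ (by simp) (by simp)
    simpa [eq_inv_iff_mul_eq_one] using fun h' => h (hx h')

/-- A finite set closed under inversion and without involutions has an ordered product `1`. -/
theorem HasOrderedProd.of_forall_inv_mem {A : Finset G} (hinv : ∀ x ∈ A, x⁻¹ ∈ A)
    (hA : ∀ x ∈ A, x * x = 1 → x = 1) : HasOrderedProd A 1 := by
  refine .of_blocks (fun x => {x, x⁻¹}) A (by simp) ?_ ?_ fun x hx => .pair_inv (hA x hx)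
  · intro x hx y hy
    simp only [Finset.mem_insert, Finset.mem_singleton] at hy
    rcases hy with rfl | rfl
    exacts [hx, hinv _ hx]
  · intro x hx y hy
    simp only [Finset.mem_insert, Finset.mem_singleton] at hy
    rcases hy with rfl | rfl
    · rfl
    · rw [inv_inv, Finset.pair_comm]

/-! ### Blocks attached to an involution. -/

section Involution

variable {t : G}

/-- The orbit of `x` under left and right multiplication by an involution `t`. -/
def doubleOrbit (t x : G) : Finset G := {x, x * t, t * x * t, t * x}

theorem doubleOrbit_eq (ht : t * t = 1) {x y : G} (hy : y ∈ doubleOrbit t x) :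
    doubleOrbit t y = doubleOrbit t x := by
  have ht' (y : G) : t * (t * y) = y := by rw [← mul_assoc, ht, one_mul]
  simp only [doubleOrbit, Finset.mem_insert, Finset.mem_singleton] at hy ⊢
  rcases hy with rfl | rfl | rfl | rfl <;> ext z <;>
    simp only [mul_assoc, ht, ht', mul_one, Finset.mem_insert, Finset.mem_singleton] <;> tauto

/-- In the order `x, x * t, t * x * t, t * x` the factors `t` cancel and `x ^ 4 = 1` remains;
noncommutation makes the four elements distinct. -/
theorem HasOrderedProd.doubleOrbit_of_mul_self (ht : t * t = 1) {x : G} (hxt : x * t ≠ t * x)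
    (hx : x * x = 1) : HasOrderedProd (doubleOrbit t x) 1 := by
  have ht' (y : G) : t * (t * y) = y := by rw [← mul_assoc, ht, one_mul]
  have h1 : t ≠ 1 := by rintro rfl; simp at hxt
  have h2 : t * x * t ≠ x := fun h => hxt <| by
    conv_lhs => rw [← h]
    simp [mul_assoc, ht]
  refine .of_list [x, x * t, t * x * t, t * x] ?_ (by simp [doubleOrbit]) ?_
  · simp only [List.nodup_cons, List.mem_cons, List.not_mem_nil, not_or, or_false]
    refine ⟨⟨?_, h2.symm, ?_⟩, ⟨?_, hxt⟩, ?_, by simp, by simp⟩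
    · simpa using h1
    · simpa using h1
    · intro h
      have : x = t * x := mul_right_cancel h
      simp [h1] at this
    · simpa using h1
  · simp [mul_assoc, ht, ht', hx]

theorem IsDihedralWith.hasOrderedProd (ht : t * t = 1) {x : G} (h : IsDihedralWith t x) :
    HasOrderedProd (doubleOrbit t x) 1 := by
  obtain ⟨hxt, hx | hx⟩ := h
  · exact .doubleOrbit_of_mul_self ht hxt hx
  · rw [← doubleOrbit_eq ht (show x * t ∈ doubleOrbit t x by simp [doubleOrbit])]
    refine .doubleOrbit_of_mul_self ht (fun h => hxt ?_) hx
    rw [← mul_assoc] at h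
    exact mul_right_cancel h

theorem IsDihedralWith.of_mem (ht : t * t = 1) {x y : G} (h : IsDihedralWith t x)
    (hy : y ∈ doubleOrbit t x) : IsDihedralWith t y := by
  have ht' (y : G) : t * (t * y) = y := by rw [← mul_assoc, ht, one_mul]
  obtain ⟨h1, h2⟩ := h
  have h1' : x ≠ t * (x * t) := fun h => h1 <| by
    conv_lhs => rw [h]
    simp [mul_assoc, ht]
  have h3 : t * (x * (t * x)) = 1 ↔ x * (t * (x * t)) = 1 := by
    rw [mul_eq_one_iff_eq_inv', ← mul_eq_one_iff_eq_inv]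
    simp [mul_assoc]
  have h4 : t * (x * (x * t)) = 1 ↔ x * x = 1 := by
    rw [mul_eq_one_iff_eq_inv', ← mul_eq_one_iff_eq_inv]
    simp [mul_assoc, ht]
  simp only [doubleOrbit, Finset.mem_insert, Finset.mem_singleton] at hy
  rcases hy with rfl | rfl | rfl | rfl <;> unfold IsDihedralWith <;>
    simp only [mul_assoc, ht, ht', mul_one, ne_eq, h3, h4] at h1 h1' h2 ⊢ <;> grind

theorem HasOrderedProd.pair_mul {u : G} (h1 : t ≠ 1) (hu : u * u = 1) :
    HasOrderedProd ({u, u * t} : Finset G) t :=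
  .of_list [u, u * t] (by simpa using h1) (by simp) (by simp [← mul_assoc, hu])

/-- The union of two pairs `{u, u * t}` and `{v, v * t}` of commuting involutions has an ordered
product `1`. -/
theorem HasOrderedProd.two_pairs (ht : t * t = 1) (h1 : t ≠ 1) {u v : G}
    (hu : u * u = 1) (hv : v * v = 1) (huv : u ≠ v) (huvt : u ≠ v * t) :
    HasOrderedProd ({u, u * t, v, v * t} : Finset G) 1 := by
  rw [← ht]
  have := (HasOrderedProd.pair_mul h1 hu).union (.pair_mul h1 hv) ?_
  · rwa [Finset.insert_union, Finset.singleton_union] at this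
  · simp only [Finset.disjoint_insert_left, Finset.disjoint_singleton_left, Finset.mem_insert,
      Finset.mem_singleton, mul_left_inj, not_or]
    refine ⟨⟨huv, huvt⟩, fun h => huvt ?_, huv⟩
    rw [← h, mul_assoc, ht, mul_one]

end Involution

end OrderedProducts

/-! ### Full products equal to 1, from a commutator or a Klein four-group. -/

section Sufficiency

variable {G : Type*} [Group G] [Fintype G] [DecidableEq G] {t : G}

/-- The elements of exponent two that commute with `t`. -/
def commutingInvolutions (t : G) : Finset G :=
  Finset.univ.filter fun u => u * u = 1 ∧ u * t = t * u

theorem mem_commutingInvolutions {u : G} :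
    u ∈ commutingInvolutions t ↔ u * u = 1 ∧ u * t = t * u := by
  simp [commutingInvolutions]

theorem mul_mem_commutingInvolutions {u v : G} (hu : u ∈ commutingInvolutions t)
    (hv : v ∈ commutingInvolutions t) (huv : u * v = v * u) :
    u * v ∈ commutingInvolutions t := by
  rw [mem_commutingInvolutions] at *
  refine ⟨?_, ?_⟩
  · rw [← mul_assoc, mul_assoc u v u, ← huv, ← mul_assoc u u v, hu.1, one_mul, hv.1]
  · rw [mul_assoc, hv.2, ← mul_assoc, hu.2, mul_assoc]

theorem self_mem_commutingInvolutions (ht : t * t = 1) : t ∈ commutingInvolutions t := by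
  simp [mem_commutingInvolutions, ht]

/-- To order the whole group with product `1` it is enough to do so for the elements of exponent
two centralizing an involution `t`, possibly together with other elements centralizing `t`. -/
theorem HasOrderedProd.univ_of_commutingInvolutions (ht : t * t = 1) {W : Finset G}
    (hW : ∀ w ∈ W, w * t = t * w ∧ w * w ≠ 1 ∧ w⁻¹ ∈ W)
    (h : HasOrderedProd (commutingInvolutions t ∪ W) 1) :
    HasOrderedProd (Finset.univ : Finset G) 1 := by
  classical
  rw [← one_mul (1 : G)]
  refine .of_sdiff (Finset.subset_univ _) h ?_
  have hmem (x : G) : x ∈ Finset.univ \ (commutingInvolutions t ∪ W) ↔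
      ¬ (x * x = 1 ∧ x * t = t * x) ∧ x ∉ W := by
    simp [mem_commutingInvolutions]
  have hdih (x : G) (hx : IsDihedralWith t x) :
      x ∈ Finset.univ \ (commutingInvolutions t ∪ W) := by
    rw [hmem]
    exact ⟨fun h => hx.1 h.2, fun h => hx.1 (hW x h).1⟩
  have hinv (x : G) (hx : x ∈ Finset.univ \ (commutingInvolutions t ∪ W)) :
      x⁻¹ ∈ Finset.univ \ (commutingInvolutions t ∪ W) := by
    rw [hmem] at hx ⊢
    refine ⟨fun h' => hx.1 ⟨?_, ?_⟩, fun h' => hx.2 (by simpa using (hW _ h').2.2)⟩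
    · simpa [← mul_inv_rev] using h'.1
    · exact (Commute.inv_left_iff (a := x) (b := t)).1 h'.2
  -- An element of exponent two in the complement does not commute with `t`, so it falls in a double
  -- orbit; hence every inverse pair has two distinct elements.
  refine .of_blocks (fun x => if IsDihedralWith t x then doubleOrbit t x else {x, x⁻¹}) _
    ?_ ?_ ?_ ?_
  · intro x _
    split_ifs <;> simp [doubleOrbit]
  · intro x hx y hy
    split_ifs at hy with hd
    · exact hdih y (hd.of_mem ht hy)
    · simp only [Finset.mem_insert, Finset.mem_singleton] at hy
      rcases hy with rfl | rfl
      exacts [hx, hinv _ hx]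
  · intro x hx y hy
    split_ifs at hy with hd
    · rw [if_pos hd, if_pos (hd.of_mem ht hy), doubleOrbit_eq ht hy]
    · simp only [Finset.mem_insert, Finset.mem_singleton] at hy
      rcases hy with rfl | rfl
      · rfl
      · rw [if_neg hd, if_neg (by rwa [IsDihedralWith.inv_iff ht]), inv_inv, Finset.pair_comm]
  · intro x hx
    split_ifs with hd
    · exact hd.hasOrderedProd ht
    · refine .pair_inv fun hxx => ?_
      rw [hmem] at hx
      exact absurd ⟨fun h => hx.1 ⟨hxx, h⟩, Or.inl hxx⟩ hd

/-- Each pair `{y, y * t}` contributes a factor `t`, so the parity of the number of pairs decides.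
-/
theorem HasOrderedProd.one_or_of_pairs (ht : t * t = 1) (h1 : t ≠ 1) (Y : Finset G)
    (hY : Y ⊆ commutingInvolutions t) (hYt : ∀ y ∈ Y, y * t ∈ Y) :
    HasOrderedProd Y 1 ∨ HasOrderedProd Y t := by
  induction Y using Finset.strongInduction with
  | H Y ih =>
    obtain rfl | ⟨x, hx⟩ := Y.eq_empty_or_nonempty
    · exact .inl .empty
    have hx1 := (mem_commutingInvolutions.1 (hY hx)).1
    have hsub : {x, x * t} ⊆ Y := by
      simp [Finset.insert_subset_iff, hx, hYt x hx]
    have hp := HasOrderedProd.pair_mul h1 hx1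
    obtain h | h := ih (Y \ {x, x * t}) (Finset.sdiff_ssubset hsub (by simp))
      (Finset.sdiff_subset.trans hY) (fun y hy => by
        simp only [Finset.mem_sdiff, Finset.mem_insert, Finset.mem_singleton, not_or] at hy ⊢
        refine ⟨hYt y hy.1, fun h => hy.2.2 ?_, fun h => hy.2.1 (mul_right_cancel h)⟩
        rw [← h, mul_assoc, ht, mul_one])
    · right; simpa using hp.of_sdiff hsub h
    · left; simpa [ht] using hp.of_sdiff hsub h

/-- If the involution `t` is a commutator of elements centralizing it, then the group has an
ordered product `1`. -/
theorem HasOrderedProd.univ_of_commutator (ht : t * t = 1) (h1 : t ≠ 1) {x z : G}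
    (hx : x * t = t * x) (hz : z * t = t * z) (hxz : x * z = z * x * t) :
    HasOrderedProd (Finset.univ : Finset G) 1 := by
  have hzx : z * x = x * z * t := by rw [hxz, mul_assoc, ht, mul_one]
  have hne : x * z ≠ z * x := by simpa [hxz] using h1
  -- If only `x` squares to 1, swap `x` and `z`; if both do, replace `x` by `x * z`, whose square is
  -- `t`.
  wlog hxx : x * x ≠ 1 generalizing x z
  · rw [not_not] at hxx
    by_cases hzz : z * z = 1
    · have h2 : x * z * z = z * (x * z) * t :=
        calc x * z * z = z * x * (t * z) := by rw [hxz, mul_assoc]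
          _ = z * (x * z) * t := by rw [← hz]; simp only [mul_assoc]
      have h3 : x * z * (x * z) = t :=
        calc x * z * (x * z) = z * x * (t * x) * z := by rw [hxz]; simp only [mul_assoc, hxz]
          _ = z * (x * x) * (t * z) := by rw [← hx]; simp only [mul_assoc]
          _ = t := by rw [hxx, mul_one, ← hz, ← mul_assoc, hzz, one_mul]
      refine this (Commute.mul_left hx hz) hz h2 ?_ ?_ (h3 ▸ h1)
      · rw [h2, mul_assoc, ht, mul_one]
      · rw [h2]
        simpa using h1
    · exact this hz hx hzx hxz hne.symm hzz
  have hxx' : x ≠ x⁻¹ := by rwa [ne_eq, eq_inv_iff_mul_eq_one]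
  have hxinv : x⁻¹ * t = t * x⁻¹ := Commute.inv_left hx
  have hzinv : z⁻¹ * t = t * z⁻¹ := Commute.inv_left hz
  have hxz1 : x ≠ z := by rintro rfl; exact hne rfl
  have hxz2 : x ≠ z⁻¹ := by rintro rfl; simp at hne
  have hxz3 : x⁻¹ ≠ z := by rintro rfl; simp at hne
  by_cases hzz : z * z = 1
  · have hzC : z ∈ commutingInvolutions t := mem_commutingInvolutions.2 ⟨hzz, hz⟩
    have hztC : z * t ∈ commutingInvolutions t :=
      mul_mem_commutingInvolutions hzC (self_mem_commutingInvolutions ht) hz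
    have hsub : {z, z * t} ⊆ commutingInvolutions t := by
      simp [Finset.insert_subset_iff, hzC, hztC]
    have hxC : x ∉ commutingInvolutions t := fun h => hxx (mem_commutingInvolutions.1 h).1
    have hxinvC : x⁻¹ ∉ commutingInvolutions t := fun h => hxx <| by
      simpa [← mul_inv_rev] using (mem_commutingInvolutions.1 h).1
    obtain h | h := HasOrderedProd.one_or_of_pairs ht h1 (commutingInvolutions t \ {z, z * t})
      Finset.sdiff_subset (fun y hy => by
        simp only [Finset.mem_sdiff, Finset.mem_insert, Finset.mem_singleton, not_or] at hy ⊢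
        refine ⟨mul_mem_commutingInvolutions hy.1 (self_mem_commutingInvolutions ht)
          (mem_commutingInvolutions.1 hy.1).2, fun h => hy.2.2 ?_,
          fun h => hy.2.1 (mul_right_cancel h)⟩
        rw [← h, mul_assoc, ht, mul_one])
    -- The pair `{z, z * t}`, interleaved with `x` and `x⁻¹`, now has product 1 instead of `t`.
    · have hq : HasOrderedProd ({x, z, x⁻¹, z * t} : Finset G) 1 := by
        refine .of_list [x, z, x⁻¹, z * t] ?_ (by simp) ?_
        · have h4 : x ≠ z * t := fun h => hxC (h ▸ hztC)
          have h5 : x⁻¹ ≠ z * t := fun h => hxinvC (h ▸ hztC)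
          simp [hxz1, hxx', h4, hxz3.symm, h1, h5]
        · simp only [List.prod_cons, List.prod_nil, mul_one]
          calc x * (z * (x⁻¹ * (z * t))) = x * z * x⁻¹ * z * t := by simp only [mul_assoc]
            _ = z * x * (t * x⁻¹) * z * t := by rw [hxz]; simp only [mul_assoc]
            _ = z * (t * z) * t := by rw [← hxinv]; simp [mul_assoc]
            _ = 1 := by rw [← hz, mul_assoc, mul_assoc, ht, mul_one, hzz]
      refine .univ_of_commutingInvolutions ht (W := {x, x⁻¹}) ?_ ?_
      · intro w hw
        simp only [Finset.mem_insert, Finset.mem_singleton] at hw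
        rcases hw with rfl | rfl
        · exact ⟨hx, hxx, by simp⟩
        · refine ⟨hxinv, fun h => hxx ?_, by simp⟩
          simpa [← mul_inv_rev] using h
      · have := hq.union h ?_
        · convert this using 1
          · ext y
            have := @hsub y
            simp only [Finset.mem_union, Finset.mem_sdiff, Finset.mem_insert,
              Finset.mem_singleton] at this ⊢
            tauto
          · rw [mul_one]
        · simp [hxC, hxinvC]
    · have := (HasOrderedProd.pair_mul h1 hzz).of_sdiff hsub h
      refine .univ_of_commutingInvolutions ht (W := ∅) (by simp) ?_
      simpa [ht] using this
  · obtain h | h := HasOrderedProd.one_or_of_pairs ht h1 (commutingInvolutions t)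
      subset_rfl (fun y hy => mul_mem_commutingInvolutions hy (self_mem_commutingInvolutions ht)
          (mem_commutingInvolutions.1 hy).2)
    · exact .univ_of_commutingInvolutions ht (W := ∅) (by simp) (by simpa using h)
    -- The commutator itself supplies the second factor `t`.
    · have hq : HasOrderedProd ({x, z, x⁻¹, z⁻¹} : Finset G) t := by
        refine .of_list [x, z, x⁻¹, z⁻¹] ?_ (by simp) ?_
        · have h4 : z ≠ z⁻¹ := by rwa [ne_eq, eq_inv_iff_mul_eq_one]
          simp [hxz1, hxz2, hxx', h4, hxz3.symm]
        · simp only [List.prod_cons, List.prod_nil, mul_one]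
          rw [← mul_assoc, hxz, ← mul_assoc (z * x * t), mul_assoc (z * x), ← hxinv]
          simp only [mul_assoc, mul_inv_cancel_left]
          rw [← hzinv, mul_inv_cancel_left]
      have hWmem : ∀ w ∈ ({x, z, x⁻¹, z⁻¹} : Finset G),
          w * t = t * w ∧ w * w ≠ 1 ∧ w⁻¹ ∈ ({x, z, x⁻¹, z⁻¹} : Finset G) := by
        intro w hw
        simp only [Finset.mem_insert, Finset.mem_singleton] at hw
        rcases hw with rfl | rfl | rfl | rfl
        · exact ⟨hx, hxx, by simp⟩
        · exact ⟨hz, hzz, by simp⟩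
        · refine ⟨hxinv, fun h => hxx ?_, by simp⟩
          simpa [← mul_inv_rev] using h
        · refine ⟨hzinv, fun h => hzz ?_, by simp⟩
          simpa [← mul_inv_rev] using h
      refine .univ_of_commutingInvolutions ht hWmem ?_
      have := h.union hq ?_
      · rwa [ht] at this
      · rw [Finset.disjoint_left]
        exact fun w hw hw' => (hWmem w hw').2.1 (mem_commutingInvolutions.1 hw).1

/-- A finite group containing a Klein four-group has an ordered product `1`. -/
theorem HasOrderedProd.univ_of_klein {a : G} (ht : t * t = 1) (h1 : t ≠ 1) (ha : a * a = 1)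
    (ha1 : a ≠ 1) (hat : a * t = t * a) (hne : a ≠ t) :
    HasOrderedProd (Finset.univ : Finset G) 1 := by
  by_cases hcomm : ∃ u ∈ commutingInvolutions t, a * u = u * a * t
  · obtain ⟨u, hu, hau⟩ := hcomm
    exact .univ_of_commutator ht h1 hat (mem_commutingInvolutions.1 hu).2 hau
  push Not at hcomm
  refine .univ_of_commutingInvolutions ht (W := ∅) (by simp) ?_
  rw [Finset.union_empty]
  have haC : a ∈ commutingInvolutions t := mem_commutingInvolutions.2 ⟨ha, hat⟩
  have ha' (y : G) : a * (a * y) = y := by rw [← mul_assoc, ha, one_mul]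
  -- `σ` induces a fixed-point-free involution on the pairs `{u, u * t}`: `a ∉ {1, t}` handles the
  -- first branch, and `hcomm` rules out `a * u * a = u * t` in the second.
  let σ : G → G := fun u => if u * a = a * u then u * a else a * u * a
  have hσ (u : G) (hu : u ∈ commutingInvolutions t) : σ u ∈ commutingInvolutions t := by
    by_cases h : u * a = a * u
    · simpa [σ, h] using mul_mem_commutingInvolutions haC hu h.symm
    · rw [mem_commutingInvolutions] at hu ⊢
      simp only [σ, if_neg h]
      refine ⟨?_, (Commute.mul_left hat hu.2).mul_left hat⟩
      simp only [mul_assoc, ha']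
      rw [← mul_assoc u u, hu.1, one_mul, ha]
  have hσσ (u : G) : σ (σ u) = u := by
    by_cases h : u * a = a * u
    · have h' : u * a * a = a * (u * a) := by rw [h, mul_assoc, h]
      simp only [σ, if_pos h, if_pos h']
      rw [mul_assoc, ha, mul_one]
    · have h' : ¬ a * u * a * a = a * (a * u * a) := by
        simpa only [mul_assoc, ha, ha', mul_one] using fun h' => h (Eq.symm h')
      simp only [σ, if_neg h, if_neg h']
      simp only [mul_assoc, ha, ha', mul_one]
  have hσt (u : G) : σ (u * t) = σ u * t := by
    have h' : u * t * a = a * (u * t) ↔ u * a = a * u := by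
      rw [mul_assoc, ← hat, ← mul_assoc, ← mul_assoc, mul_left_inj]
    simp only [σ, h']
    split_ifs <;> simp only [mul_assoc, hat]
  have hσ1 (u : G) : σ u ≠ u := by
    by_cases h : u * a = a * u
    · simpa only [σ, if_pos h, ne_eq, mul_eq_left] using ha1
    · simp only [σ, if_neg h]
      intro h'
      apply h
      conv_rhs => rw [← h']
      simp only [mul_assoc, ha']
  have hσ2 (u : G) (hu : u ∈ commutingInvolutions t) : σ u ≠ u * t := by
    by_cases h : u * a = a * u
    · simpa only [σ, if_pos h, ne_eq, mul_right_inj] using hne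
    · simp only [σ, if_neg h]
      intro h'
      apply hcomm u hu
      calc a * u = a * u * a * a := by rw [mul_assoc _ a a, ha, mul_one]
        _ = u * a * t := by rw [h', mul_assoc, ← hat, mul_assoc]
  refine .of_blocks (fun u => {u, u * t, σ u, σ u * t}) _ (by simp) ?_ ?_ ?_
  · intro u hu
    have htC := self_mem_commutingInvolutions ht
    simp only [Finset.insert_subset_iff, Finset.singleton_subset_iff]
    exact ⟨hu, mul_mem_commutingInvolutions hu htC (mem_commutingInvolutions.1 hu).2, hσ u hu,
      mul_mem_commutingInvolutions (hσ u hu) htC (mem_commutingInvolutions.1 (hσ u hu)).2⟩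
  · intro u hu y hy
    simp only [Finset.mem_insert, Finset.mem_singleton] at hy
    rcases hy with rfl | rfl | rfl | rfl
    · rfl
    all_goals
      ext z
      simp only [hσt, hσσ, mul_assoc, ht, mul_one, Finset.mem_insert,
        Finset.mem_singleton]
      tauto
  · intro u hu
    refine .two_pairs ht h1 (mem_commutingInvolutions.1 hu).1
      (mem_commutingInvolutions.1 (hσ u hu)).1 (hσ1 u).symm fun h => hσ2 u hu ?_
    conv_rhs => rw [h, mul_assoc, ht, mul_one]

end Sufficiency

/-! ### Structure of Sylow 2-subgroups: noncyclic ones suffice. -/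

section Sylow

/-- A finite commutative `2`-group with at most one involution is cyclic. -/
theorem isCyclic_of_unique_involution {P : Type*} [Group P] [Finite P] (hP : IsPGroup 2 P)
    (hcomm : ∀ x y : P, x * y = y * x)
    (huniq : ∀ x y : P, x * x = 1 → y * y = 1 → x ≠ 1 → y ≠ 1 → x = y) : IsCyclic P := by
  classical
  cases nonempty_fintype P
  have hpow (k : ℕ) : (Finset.univ.filter fun x : P => x ^ 2 ^ k = 1).card ≤ 2 ^ k := by
    induction k with
    | zero =>
      rw [pow_zero, Finset.card_le_one]
      simp
    | succ k ih =>
      -- Squaring has fibres of size at most 2, since two elements with equal squares differ by a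
      -- factor of exponent two.
      have := Finset.card_le_mul_card_image_of_maps_to
        (s := Finset.univ.filter fun x : P => x ^ 2 ^ (k + 1) = 1)
        (t := Finset.univ.filter fun x : P => x ^ 2 ^ k = 1) (f := fun x => x * x)
        (fun x hx => by
          simp only [Finset.mem_filter, Finset.mem_univ, true_and] at hx ⊢
          rwa [← pow_two, ← pow_mul, ← pow_succ']) 2 (fun y _ => by
          by_contra! hc
          obtain ⟨u, hu, v, hv, w, hw, huv, huw, hvw⟩ := Finset.two_lt_card.1 hc
          simp only [Finset.mem_filter, Finset.mem_univ, true_and] at hu hv hw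
          have key (p q : P) (hp : p * p = y) (hq : q * q = y) :
              (p⁻¹ * q) * (p⁻¹ * q) = 1 := by
            rw [Commute.mul_mul_mul_comm (hcomm q p⁻¹), ← mul_inv_rev, hp, hq, inv_mul_cancel]
          have := huniq _ _ (key u v hu.2 hv.2) (key u w hu.2 hw.2)
            (by rwa [ne_eq, inv_mul_eq_one]) (by rwa [ne_eq, inv_mul_eq_one])
          exact hvw (mul_left_cancel this))
      calc _ ≤ _ := this
        _ ≤ 2 ^ (k + 1) := by rw [pow_succ']; gcongr
  refine isCyclic_of_card_pow_eq_one_le fun n hn => ?_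
  obtain ⟨k, m, hm, rfl⟩ := Nat.exists_eq_two_pow_mul_odd hn.ne'
  -- In a 2-group the odd factor `m` of the exponent can be dropped.
  calc _ ≤ (Finset.univ.filter fun x : P => x ^ 2 ^ k = 1).card := by
        refine Finset.card_le_card fun x hx => ?_
        simp only [Finset.mem_filter, Finset.mem_univ, true_and] at hx ⊢
        rw [pow_mul] at hx
        obtain ⟨j, hj⟩ := hP (x ^ 2 ^ k)
        have := Nat.Coprime.pow_left j (Nat.coprime_two_left.2 hm)
        have h := pow_gcd_eq_one.2 ⟨hj, hx⟩
        rwa [this, pow_one] at h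
    _ ≤ 2 ^ k := hpow k
    _ ≤ 2 ^ k * m := Nat.le_mul_of_pos_right _ hm.pos

/-- In a noncommutative finite `2`-group some central involution is a commutator. -/
theorem exists_central_commutator {P : Type*} [Group P] [Finite P] (hP : IsPGroup 2 P)
    {p q : P} (hpq : p * q ≠ q * p) :
    ∃ x z t : P, t * t = 1 ∧ t ≠ 1 ∧ (∀ g, g * t = t * g) ∧ x * z = z * x * t := by
  have : Fact (Nat.Prime 2) := ⟨Nat.prime_two⟩
  let Q := P ⧸ Subgroup.center P
  have hQ : IsPGroup 2 Q := hP.to_quotient _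
  have : Nontrivial Q := by
    refine (QuotientGroup.nontrivial_iff).2 fun h => hpq ?_
    have : p ∈ Subgroup.center P := h ▸ Subgroup.mem_top p
    exact (Subgroup.mem_center_iff.1 this q).symm
  have := hQ.center_nontrivial
  have hZ : IsPGroup 2 (Subgroup.center Q) := hQ.to_subgroup _
  obtain ⟨n, hn, hcard⟩ := (IsPGroup.nontrivial_iff_card hZ).1 inferInstance
  -- Lift a central involution of `P / Z(P)` to `z`. Commutators with `z` are central, and they
  -- square to 1 because `z * z` is central.
  obtain ⟨c, hc⟩ := exists_prime_orderOf_dvd_card' (G := Subgroup.center Q) 2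
    (hcard ▸ dvd_pow_self 2 hn.ne')
  obtain ⟨z, hz⟩ := QuotientGroup.mk_surjective (c : Q)
  have hz1 : z ∉ Subgroup.center P := by
    rw [← QuotientGroup.eq_one_iff, hz, OneMemClass.coe_eq_one, ← orderOf_eq_one_iff, hc]
    norm_num
  have hz2 : z * z ∈ Subgroup.center P := by
    have h := pow_orderOf_eq_one c
    rw [hc, pow_two] at h
    rw [← QuotientGroup.eq_one_iff, QuotientGroup.mk_mul, hz, ← Subgroup.coe_mul, h,
      Subgroup.coe_one]
  rw [Subgroup.mem_center_iff] at hz1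
  push Not at hz1
  obtain ⟨x, hx⟩ := hz1
  let t := (z * x)⁻¹ * (x * z)
  have htC : t ∈ Subgroup.center P := by
    rw [← QuotientGroup.eq_one_iff]
    have := Subgroup.mem_center_iff.1 c.2 (x : Q)
    simp only [t, QuotientGroup.mk_mul, QuotientGroup.mk_inv, hz, this, inv_mul_cancel]
  have ht (g : P) : g * t = t * g := Subgroup.mem_center_iff.1 htC g
  have hxz : x * z = z * x * t := by simp only [t, mul_inv_cancel_left]
  refine ⟨x, z, t, ?_, fun h => hx (by simpa [h] using hxz), ht, hxz⟩
  have h1 : x * (z * z) = z * z * x * (t * t) := by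
    rw [← mul_assoc, hxz, mul_assoc (z * x), ← ht, ← mul_assoc, mul_assoc z x z, hxz]
    simp only [mul_assoc]
  rw [Subgroup.mem_center_iff.1 hz2 x] at h1
  simpa using h1

variable {G : Type*} [Group G] [Fintype G] [DecidableEq G]

theorem hasOrderedProd_univ_of_sylow (P : Sylow 2 G)
    (hP : (P : Subgroup G) = ⊥ ∨ ¬ IsCyclic P) :
    HasOrderedProd (Finset.univ : Finset G) 1 := by
  have : Fact (Nat.Prime 2) := ⟨Nat.prime_two⟩
  obtain hP | hP := hP
  · refine .of_forall_inv_mem (by simp) fun x _ hx => ?_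
    have h2 : ¬ 2 ∣ Nat.card G := by
      have := P.not_dvd_index
      rwa [hP, Subgroup.index_bot] at this
    have hx2 : orderOf x ∣ 2 := orderOf_dvd_of_pow_eq_one (by rw [pow_two, hx])
    rcases (Nat.dvd_prime Nat.prime_two).1 hx2 with h | h
    · exact orderOf_eq_one_iff.1 h
    · exact absurd (h ▸ orderOf_dvd_natCard x) h2
  · by_cases hcomm : ∀ x y : P, x * y = y * x
    · have := mt (isCyclic_of_unique_involution P.isPGroup' hcomm) hP
      push Not at this
      obtain ⟨x, y, hx, hy, hx1, hy1, hxy⟩ := this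
      have hxy' := hcomm x y
      simp only [Subtype.ext_iff, Subgroup.coe_mul, Subgroup.coe_one, ne_eq] at hx hy hx1 hy1 hxy hxy'
      exact .univ_of_klein hy hy1 hx hx1 hxy' hxy
    · push Not at hcomm
      obtain ⟨p, q, hpq⟩ := hcomm
      obtain ⟨x, z, t, ht, h1, htc, hxz⟩ := exists_central_commutator P.isPGroup' hpq
      have hx := htc x
      have hz := htc z
      simp only [Subtype.ext_iff, Subgroup.coe_mul, Subgroup.coe_one, ne_eq] at ht h1 hx hz hxz
      exact .univ_of_commutator ht h1 hx hz hxz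

/-! ### Necessity: cyclic Sylow 2-subgroups and transfer. -/

/-- The product of the elements of a nontrivial cyclic `2`-group is its involution. -/
theorem prod_univ_eq_involution {C : Type*} [CommGroup C] [Fintype C] [IsCyclic C]
    (h2 : 2 ∣ Nat.card C) : ∏ x : C, x ≠ 1 ∧ (∏ x : C, x) * ∏ x : C, x = 1 := by
  classical
  have : Fact (Nat.Prime 2) := ⟨Nat.prime_two⟩
  obtain ⟨t, ht⟩ := exists_prime_orderOf_dvd_card' (G := C) 2 h2
  have ht1 : t ≠ 1 := by rw [ne_eq, ← orderOf_eq_one_iff, ht]; norm_num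
  have htt : t * t = 1 := by rw [← pow_two, ← ht, pow_orderOf_eq_one]
  have huniq (x : C) (hx : x * x = 1) : x = 1 ∨ x = t := by
    have hle := IsCyclic.card_pow_eq_one_le (α := C) (n := 2) (by norm_num)
    by_contra! hc
    have : ({1, t, x} : Finset C) ⊆ Finset.univ.filter fun a : C => a ^ 2 = 1 := by
      simp [Finset.insert_subset_iff, pow_two, hx, htt]
    have := (Finset.card_le_card this).trans hle
    rw [Finset.card_insert_of_notMem (by simp [ht1.symm, hc.1.symm]),
      Finset.card_insert_of_notMem (by simp [hc.2.symm])] at this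
    simp at this
  have key : ∏ x : C, x = t := by
    have h := Finset.prod_sdiff (f := fun x : C => x) (Finset.subset_univ ({1, t} : Finset C))
    rw [Finset.prod_pair ht1.symm, one_mul] at h
    rw [← h, mul_eq_right]
    -- Everything other than 1 and `t` cancels against its inverse.
    refine Finset.prod_involution (fun x _ => x⁻¹) (by simp) ?_ ?_ (by simp)
    · intro x hx _ hxx
      simp only [Finset.mem_sdiff, Finset.mem_insert, Finset.mem_singleton] at hx
      exact hx.2 (huniq x (by rw [← eq_inv_iff_mul_eq_one, hxx]))
    · intro x hx
      have : t⁻¹ = t := inv_eq_of_mul_eq_one_left htt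
      simpa [inv_eq_iff_eq_inv, this] using hx
  rw [key]
  exact ⟨ht1, htt⟩

/-- As 2 is the least prime divisor of the order, the normalizer of `P` centralizes it, so
Burnside's transfer onto `P` applies. The target is commutative, so the image of a full product does
not depend on the ordering. -/
theorem one_ne_of_hasOrderedProd_of_isCyclic_sylow (P : Sylow 2 G)
    (hP : (P : Subgroup G) ≠ ⊥) (hc : IsCyclic P) {g : G}
    (hg : HasOrderedProd (Finset.univ : Finset G) g) : g ≠ 1 := by
  have : Fact (Nat.Prime 2) := ⟨Nat.prime_two⟩
  have h2P : 2 ∣ Nat.card P := P.isPGroup'.card_eq_or_dvd.resolve_left fun h =>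
    hP (Subgroup.card_eq_one.1 h)
  have hmin : (Nat.card G).minFac = 2 :=
    (Nat.minFac_eq_two_iff _).2 (h2P.trans (Subgroup.card_subgroup_dvd_card _))
  have hN := hc.normalizer_le_centralizer hmin
  let : Fintype P := Fintype.ofFinite _
  let φ : G →* P := MonoidHom.transferSylow P hN
  let : CommGroup P := { (inferInstance : Group P) with
    mul_comm := fun a b => Subtype.ext (hN (Subgroup.le_normalizer b.2) a a.2) }
  have hsurj : Function.Surjective φ := by
    intro y
    -- On `P` transfer is the power map with exponent the index, which is odd.
    obtain ⟨x, hx⟩ := (P.2.powEquiv' P.not_dvd_index).surjective y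
    refine ⟨x, ?_⟩
    have := congrFun (MonoidHom.transferSylow_domRestrict_eq_pow P hN) x
    exact this.trans hx
  have hker : ¬ 2 ∣ Nat.card φ.ker := MonoidHom.not_dvd_card_ker_transferSylow P hN
  have hfib (y : P) : (Finset.univ.filter fun x => φ x = y).card = Nat.card φ.ker := by
    obtain ⟨g, rfl⟩ := hsurj y
    rw [← Fintype.card_subtype, ← Nat.card_eq_fintype_card]
    refine Nat.card_congr ⟨fun x => ⟨g⁻¹ * x, ?_⟩, fun x => ⟨g * x, ?_⟩, ?_, ?_⟩
    · simp [MonoidHom.mem_ker, x.2]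
    · simp [MonoidHom.mem_ker.1 x.2]
    · intro x; simp
    · intro x; simp
  have hprod : ∏ x : G, φ x = (∏ y : P, y) ^ Nat.card φ.ker := by
    rw [← Finset.prod_fiberwise' Finset.univ φ (fun y => y), ← Finset.prod_pow]
    refine Finset.prod_congr rfl fun y _ => ?_
    rw [Finset.prod_const, hfib]
  obtain ⟨hne, hsq⟩ := prod_univ_eq_involution (C := P) h2P
  obtain ⟨k, hk⟩ := Nat.odd_iff.2 (Nat.two_dvd_ne_zero.1 hker)
  -- An odd power of the involution is the involution.
  rw [hk, pow_succ, pow_mul, pow_two, hsq, one_pow, one_mul] at hprod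
  obtain ⟨l, hl, hmem, rfl⟩ := hg
  intro h1
  apply hne
  rw [← hprod, ← map_one φ, ← h1, map_list_prod]
  have : l.toFinset = Finset.univ := by ext; simp [hmem]
  rw [← this, List.prod_toFinset _ hl]

end Sylow

/-! ### Regular row transversals, balanced maps and full products. -/

section Transversals

variable {G : Type*} [Group G] [Fintype G] [DecidableEq G]

/-- The set of cells selecting the column `c x` in row `x`. -/
def cells (c : G → G) : Finset (G × G × G) :=
  Finset.univ.image fun x => (x, c x, x * c x)

theorem mem_cells {c : G → G} {p : G × G × G} :
    p ∈ cells c ↔ p = (p.1, c p.1, p.1 * c p.1) := by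
  simp only [cells, Finset.mem_image, Finset.mem_univ, true_and]
  exact ⟨by rintro ⟨x, rfl⟩; rfl, fun h => ⟨p.1, h.symm⟩⟩

theorem card_filter_cells (c : G → G) (p : G × G × G → Prop) [DecidablePred p] :
    ((cells c).filter p).card =
      (Finset.univ.filter fun x => p (x, c x, x * c x)).card := by
  rw [cells, Finset.filter_image, Finset.card_image_of_injective]
  exact fun x y h => congrArg Prod.fst h

theorem mem_multTable {p : G × G × G} : p ∈ multTable G ↔ p = (p.1, p.2.1, p.1 * p.2.1) := by
  simp only [multTable, Finset.mem_image, Finset.mem_univ, true_and]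
  exact ⟨by rintro ⟨x, rfl⟩; rfl, fun h => ⟨(p.1, p.2.1), h.symm⟩⟩

/-- Each element occurs as a value of `c` as often as it occurs as a value of `x ↦ x * c x`. -/
def IsBalanced (c : G → G) : Prop :=
  ∀ s, (Finset.univ.filter fun x => c x = s).card =
    (Finset.univ.filter fun x => x * c x = s).card

theorem isRegularRowTransversal_cells {c : G → G} :
    IsRegularRowTransversal (multTable G) (cells c) ↔ IsBalanced c := by
  have h1 : IsRowPlex (multTable G) 1 (cells c) := by
    refine ⟨fun p hp => ?_, fun x => ?_⟩
    · rw [mem_cells] at hp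
      rw [mem_multTable, hp]
    · rw [card_filter_cells, Finset.filter_eq', if_pos (Finset.mem_univ x),
        Finset.card_singleton]
  simp only [IsRegularRowTransversal, h1, true_and, IsRegular, card_filter_cells, IsBalanced]

theorem IsRowPlex.exists_eq_cells {T : Finset (G × G × G)} (hT : IsRowPlex (multTable G) 1 T) :
    ∃ c : G → G, T = cells c := by
  choose p hp using fun x => Finset.card_eq_one.1 (hT.2 x)
  have hp' (x : G) (q : G × G × G) : q ∈ T ∧ q.1 = x ↔ q = p x := by
    simpa using Finset.ext_iff.1 (hp x) q
  refine ⟨fun x => (p x).2.1, ?_⟩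
  ext q
  rw [mem_cells]
  constructor
  · intro hq
    rw [← (hp' q.1 q).1 ⟨hq, rfl⟩]
    exact mem_multTable.1 (hT.1 hq)
  · intro hq
    obtain ⟨h1, h2⟩ := (hp' q.1 (p q.1)).2 rfl
    have := mem_multTable.1 (hT.1 h1)
    rw [h2] at this
    rwa [hq, ← this]

theorem IsBalanced.mul_right {c : G → G} (hc : IsBalanced c) (g : G) :
    IsBalanced fun x => c x * g := by
  intro s
  simpa only [← mul_assoc, ← eq_mul_inv_iff_mul_eq] using hc (s * g⁻¹)

theorem exists_isRegularRowTransversal_iff :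
    (∃ T : Finset (G × G × G), IsRegularRowTransversal (multTable G) T) ↔
      ∃ c : G → G, IsBalanced c := by
  constructor
  · rintro ⟨T, hT⟩
    obtain ⟨c, rfl⟩ := hT.1.exists_eq_cells
    exact ⟨c, isRegularRowTransversal_cells.1 hT⟩
  · rintro ⟨c, hc⟩
    exact ⟨cells c, isRegularRowTransversal_cells.2 hc⟩

theorem IsBalanced.exists_partition {c : G → G} (hc : IsBalanced c) {n : ℕ}
    (hn : Fintype.card G = n) :
    ∃ T : Fin n → Finset (G × G × G),
      (∀ i, IsRegularRowTransversal (multTable G) (T i)) ∧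
      (∀ i j, i ≠ j → Disjoint (T i) (T j)) ∧ Finset.univ.biUnion T = multTable G := by
  let e : G ≃ Fin n := Fintype.equivFinOfCardEq hn
  refine ⟨fun i => cells fun x => c x * e.symm i,
    fun i => isRegularRowTransversal_cells.2 (hc.mul_right _), fun i j hij => ?_, ?_⟩
  · rw [Finset.disjoint_left]
    intro p hi hj
    rw [mem_cells] at hi hj
    have := congrArg (fun q => q.2.1) (hi.symm.trans hj)
    exact hij (e.symm.injective (mul_left_cancel this))
  · ext p
    simp only [Finset.mem_biUnion, Finset.mem_univ, true_and, mem_cells, mem_multTable]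
    constructor
    · rintro ⟨i, hi⟩
      rw [hi]
    · intro hp
      -- The only translate of `c` that takes the column of `p` in its row.
      refine ⟨e ((c p.1)⁻¹ * p.2.1), ?_⟩
      simpa using hp

/-- Two functions with fibres of equal sizes differ by a permutation. -/
theorem exists_perm_comp_eq {α β : Type*} [Fintype α] [DecidableEq β] (f g : α → β)
    (h : ∀ s, (Finset.univ.filter fun x => f x = s).card =
      (Finset.univ.filter fun x => g x = s).card) :
    ∃ π : Equiv.Perm α, ∀ x, f (π x) = g x := by
  have e (s : β) : Nonempty ({x // g x = s} ≃ {x // f x = s}) := by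
    rw [← Fintype.card_eq, Fintype.card_subtype, Fintype.card_subtype, h]
  refine ⟨(Equiv.sigmaFiberEquiv g).symm.trans ((Equiv.sigmaCongrRight fun s => (e s).some).trans
    (Equiv.sigmaFiberEquiv f)), fun x => ?_⟩
  exact ((e (g x)).some ⟨x, rfl⟩).2

theorem IsBalanced.hasOrderedProd {c : G → G} (hc : IsBalanced c) :
    HasOrderedProd (Finset.univ : Finset G) 1 := by
  classical
  obtain ⟨π, hπ⟩ := exists_perm_comp_eq c (fun x => x * c x) hc
  refine .of_blocks (fun x => Finset.univ.filter fun y => π.SameCycle x y) _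
    (fun x _ => by simpa using Equiv.Perm.SameCycle.refl π x) (by simp) (fun x _ y hy => ?_) fun x _ => ?_
  · simp only [Finset.mem_filter, Finset.mem_univ, true_and] at hy
    ext z
    simp only [Finset.mem_filter, Finset.mem_univ, true_and]
    exact ⟨hy.trans, hy.symm.trans⟩
  -- Iterating `c (π x) = x * c x` prepends each new element, hence the reversed list; after a full
  -- period `c x` cancels.
  · have hprod (k : ℕ) :
        ((List.range k).map fun n => π^[n] x).reverse.prod * c x = c (π^[k] x) := by
      induction k with
      | zero => simp
      | succ k ih =>
        rw [List.range_succ, List.map_append, List.reverse_append, List.prod_append, mul_assoc, ih,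
          Function.iterate_succ_apply', hπ]
        simp
    have hx : x ∈ Function.periodicPts π := π.injective.mem_periodicPts x
    refine ⟨((List.range (Function.minimalPeriod π x)).map fun n => π^[n] x).reverse, ?_, ?_, ?_⟩
    · rw [List.nodup_reverse]
      exact Function.nodup_periodicOrbit (f := π) (x := x)
    · intro y
      rw [List.mem_reverse]
      refine (Function.mem_periodicOrbit_iff (y := y) hx).trans ?_
      simp only [Finset.mem_filter, Finset.mem_univ, true_and]
      constructor
      · rintro ⟨n, rfl⟩
        exact ⟨n, by rw [zpow_natCast, Equiv.Perm.iterate_eq_pow]⟩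
      · intro h
        obtain ⟨n, hn⟩ := h.exists_nat_pow_eq
        exact ⟨n, by rw [Equiv.Perm.iterate_eq_pow, hn]⟩
    · have := hprod (Function.minimalPeriod π x)
      rwa [Function.iterate_minimalPeriod, mul_eq_right] at this

/-- With `c` the product of what follows `x` in the ordering, `x * c x` is the suffix product
starting at `x`. The two families of suffix products differ only by the empty and the full product,
both equal to 1. -/
theorem HasOrderedProd.exists_isBalanced
    (h : HasOrderedProd (Finset.univ : Finset G) 1) : ∃ c : G → G, IsBalanced c := by
  obtain ⟨l, hl, hmem, hprod⟩ := h
  let e := hl.getEquivOfForallMemList l fun x => (hmem x).2 (Finset.mem_univ x)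
  refine ⟨fun x => (l.drop (e.symm x + 1)).prod, fun s => ?_⟩
  have he (x : G) : x * (l.drop (e.symm x + 1)).prod = (l.drop (e.symm x)).prod := by
    obtain ⟨i, rfl⟩ := e.surjective x
    rw [Equiv.symm_apply_apply, List.drop_eq_getElem_cons i.2, List.prod_cons]
    rfl
  simp only [he]
  -- Integer-valued, so that the difference of the two counts telescopes to `f l.length - f 0`.
  let f (i : ℕ) : ℤ := if (l.drop i).prod = s then 1 else 0
  have key (j : ℕ) : ((Finset.univ.filter fun x : G => (l.drop (e.symm x + j)).prod = s).card : ℤ) =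
      ∑ i ∈ Finset.range l.length, f (i + j) := by
    rw [Finset.sum_range, ← e.symm.sum_comp]
    simp [f, Finset.sum_boole]
  have h0 := key 0
  simp only [add_zero] at h0
  rw [← Nat.cast_inj (R := ℤ), key 1, h0, ← sub_eq_zero, ← Finset.sum_sub_distrib,
    Finset.sum_range_sub]
  simp [f, hprod]

end Transversals

end RowTransversal

theorem mainTheorem5 (G : Type*) [Group G] [Fintype G] [DecidableEq G] (n : ℕ)
    (hn : Fintype.card G = n) :
    List.TFAE
      [ ∃ T : Finset (G × G × G),
          RowTransversal.IsRegularRowTransversal (RowTransversal.multTable G) T,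
        ∃ T : Fin n → Finset (G × G × G),
          (∀ i, RowTransversal.IsRegularRowTransversal (RowTransversal.multTable G) (T i)) ∧
          (∀ i j, i ≠ j → Disjoint (T i) (T j)) ∧
          Finset.univ.biUnion T = RowTransversal.multTable G,
        ∀ P : Sylow 2 G, (P : Subgroup G) = ⊥ ∨ ¬ IsCyclic P,
        (1 : G) ∈ RowTransversal.fullProducts (Set.univ : Set G) ] := by
  rw [RowTransversal.one_mem_fullProducts_iff, RowTransversal.exists_isRegularRowTransversal_iff]
  tfae_have 1 → 2 := fun ⟨c, hc⟩ => hc.exists_partition hn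
  tfae_have 2 → 1 := fun ⟨T, hT, _⟩ =>
    RowTransversal.exists_isRegularRowTransversal_iff.1 ⟨T ⟨0, hn ▸ Fintype.card_pos⟩, hT _⟩
  tfae_have 1 → 4 := fun ⟨c, hc⟩ => hc.hasOrderedProd
  tfae_have 4 → 1 := fun h => h.exists_isBalanced
  tfae_have 3 → 4 := fun h => RowTransversal.hasOrderedProd_univ_of_sylow default (h default)
  tfae_have 4 → 3 := fun h P => by
    by_contra! hP
    exact RowTransversal.one_ne_of_hasOrderedProd_of_isCyclic_sylow P hP.1 hP.2 h rfl
  tfae_finish
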